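/- Let $H$ be a proper subgroup of a finite group $G$. Let $\mathrm{Irr}(X)$ denote the set of irreducible complex characters of a finite group $X$, let $[\alpha,\beta]=\frac1{|X|}\sum_{x\in X}\alpha(x)\overline{\beta(x)}$, and let $\chi_Y$ denote the restriction of a character $\chi$ to a subgroup $Y$. The Frobenius graph $\Gamma(G,H)$ is the bipartite graph whose vertex set is the disjoint union of $\mathrm{Irr}(G)$ and $\mathrm{Irr}(H)$, with an edge between $\chi\in\mathrm{Irr}(G)$ and $\varphi\in\mathrm{Irr}(H)$ whenever $[\chi_H,\varphi]\neq 0$. Let $K:=\mathrm{Core}_G(H):=\bigcap_{g\in G}gHg^{-1}$, and let $G$ act on $\mathrm{Irr}(K)$ by conjugation, $({}^g\theta)(k)=\theta(g^{-1}kg)$. Then the connected components of $\Gamma(G,H)$ are in bijection with the $G$-orbits on $\mathrm{Irr}(K)$. More precisely, there is a bijection $f$ from the set of connected components to the set of $G$-orbits such that, for all $\theta\in\mathrm{Irr}(K)$: for $\chi\in\mathrm{Irr}(G)$, $f$ maps the component of $\chi$ to the orbit of $\theta$ if and only if $[\chi_K,\theta]\neq 0$; and for $\varphi\in\mathrm{Irr}(H)$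 with $[\varphi_K,\theta]\ne 0$, $f$ maps the component of $\varphi$ to the orbit of $\theta$. In particular, $\Gamma(G,H)$ is connected if and only if $K=1$. -/

import Mathlib

namespace FrobeniusGraph

/-- `χ : G → ℂ` is an irreducible complex character of `G`: the character of an irreducible
finite-dimensional complex representation. -/
def IsIrrChar {G : Type*} [Group G] (χ : G → ℂ) : Prop :=
  ∃ (V : Type) (_ : AddCommGroup V) (_ : Module ℂ V) (_ : FiniteDimensional ℂ V)
    (ρ : Representation ℂ G V), ρ.IsIrreducible ∧ ρ.character = χ

/-- `Irr(G)`, the irreducible complex characters of `G`. -/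
def Irr (G : Type*) [Group G] : Type _ := {χ : G → ℂ // IsIrrChar χ}

/-- The inner product `[α, β] = |G|⁻¹ ∑_g α(g) conj(β(g))` of class functions of a finite group. -/
noncomputable def inner {G : Type*} [Group G] [Finite G] (α β : G → ℂ) : ℂ :=
  (Nat.card G : ℂ)⁻¹ * ∑ᶠ g : G, α g * (starRingEnd ℂ) (β g)

/-- The restriction to a subgroup `H` of a function on `G`. -/
def res {G : Type*} [Group G] (H : Subgroup G) (α : G → ℂ) : H → ℂ := fun h => α h

/-- The restriction to a subgroup `K ≤ H` of a function on the subgroup `H`. -/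
def resLE {G : Type*} [Group G] {K H : Subgroup G} (h : K ≤ H) (α : H → ℂ) : K → ℂ :=
  fun k => α (Subgroup.inclusion h k)

/-- The Frobenius graph `Γ(G, H)`: the bipartite graph on `Irr(G) ⊔ Irr(H)` with an edge between
`χ ∈ Irr(G)` and `φ ∈ Irr(H)` whenever `[χ_H, φ] ≠ 0`. -/
def graph {G : Type*} [Group G] [Finite G] (H : Subgroup G) : SimpleGraph (Irr G ⊕ Irr H) where
  Adj
    | .inl χ, .inr φ => inner (res H χ.1) φ.1 ≠ 0
    | .inr φ, .inl χ => inner (res H χ.1) φ.1 ≠ 0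
    | _, _ => False
  symm := ⟨by rintro (a | a) (b | b) h <;> exact h⟩
  loopless := ⟨by rintro (a | a) h <;> exact h⟩

theorem IsIrrChar.comp_mulEquiv {G : Type*} [Group G] {χ : G → ℂ} (h : IsIrrChar χ)
    (e : G ≃* G) : IsIrrChar (fun g => χ (e g)) := by
  obtain ⟨V, i1, i2, i3, ρ, hρ, rfl⟩ := h
  refine ⟨V, i1, i2, i3, ρ.comp e.toMonoidHom, ?_, rfl⟩
  let o : Subrepresentation (ρ.comp e.toMonoidHom : Representation ℂ G V) ≃o
      Subrepresentation ρ :=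
    { toFun := fun S => ⟨S.toSubmodule, fun g v hv => by
        simpa using S.apply_mem_toSubmodule (e.symm g) hv⟩
      invFun := fun S => ⟨S.toSubmodule, fun g v hv => S.apply_mem_toSubmodule (e g) hv⟩
      left_inv := fun S => rfl
      right_inv := fun S => rfl
      map_rel_iff' := Iff.rfl }
  exact (OrderIso.isSimpleOrder_iff o).2 hρ

/-- The conjugation action of `G` on `Irr(K)` for a normal subgroup `K`:
`(g • θ)(k) = θ(g⁻¹ k g)`. -/
instance {G : Type*} [Group G] (K : Subgroup G) [K.Normal] : MulAction G (Irr K) where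
  smul g θ := ⟨fun k => θ.1 (MulAut.conjNormal g⁻¹ k), θ.2.comp_mulEquiv (MulAut.conjNormal g⁻¹)⟩
  one_smul θ := Subtype.ext (funext fun k => by
    change θ.1 (MulAut.conjNormal (1 : G)⁻¹ k) = θ.1 k
    simp)
  mul_smul g h θ := Subtype.ext (funext fun k => by
    change θ.1 (MulAut.conjNormal (g * h)⁻¹ k) =
      θ.1 (MulAut.conjNormal h⁻¹ (MulAut.conjNormal g⁻¹ k))
    rw [mul_inv_rev, map_mul, MulAut.mul_apply])

/-- The set of `G`-orbits on `Irr(K)`, for a normal subgroup `K` of `G`. -/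
abbrev Orbits {G : Type*} [Group G] (K : Subgroup G) [K.Normal] : Type _ :=
  MulAction.orbitRel.Quotient G (Irr K)

/-- The `G`-orbit of `θ ∈ Irr(K)`, as an element of the set of orbits. -/
def orbitOf {G : Type*} [Group G] {K : Subgroup G} [K.Normal] (θ : Irr K) : Orbits K :=
  Quotient.mk _ θ

end FrobeniusGraph

namespace FrobeniusGraph

/-! Let π be the permutation character on G/H. Frobenius reciprocity gives [χπ, χ'] = [χ_H, χ'_H],
so the constituents of χπ are the irreducible characters sharing a neighbour with χ, and those of
every χπⁿ are reachable from χ (`reachable_of_inner_mul_permChar_pow`). Since π(g) = |G:H| only for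
g in K, some polynomial in π is a nonzero constant on K and zero elsewhere
(`sum_normalCore_eq_zero`). If χ' is not reachable from χ, then [χπⁿ, χ'] = 0 for all n, hence [χ_K,
χ'_K] = 0. So characters over a common θ are connected.

Conversely, an edge χ–φ makes the constituents of φ_K constituents of χ_K, and by Clifford's theorem
those of χ_K form one orbit; so the orbit is constant on components. Each θ lies under some χ, so
every orbit occurs. The graph is then connected iff there is a single orbit, which forces every
irreducible character of K to be trivial, hence K = 1. -/

/-- `χ` is a complex character of `G`: the character of a finite-dimensional representation. -/
def IsChar {G : Type*} [Group G] (χ : G → ℂ) : Prop :=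
  ∃ (V : Type) (_ : AddCommGroup V) (_ : Module ℂ V) (_ : FiniteDimensional ℂ V)
    (ρ : Representation ℂ G V), ρ.character = χ

section

variable {G : Type*} [Group G]

/-! ### Closure properties of characters -/

theorem IsIrrChar.isChar {χ : G → ℂ} (h : IsIrrChar χ) : IsChar χ := by
  obtain ⟨V, i1, i2, i3, ρ, -, h⟩ := h
  exact ⟨V, i1, i2, i3, ρ, h⟩

theorem Irr.isChar (χ : Irr G) : IsChar χ.1 := χ.2.isChar

/-- The representation on `W` obtained from one on `V` along a linear equivalence. -/
def transport {V W : Type*} [AddCommGroup V] [Module ℂ V] [AddCommGroup W] [Module ℂ W]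
    (ρ : Representation ℂ G V) (e : V ≃ₗ[ℂ] W) : Representation ℂ G W :=
  (e.conjAlgEquiv ℂ : Module.End ℂ V →* Module.End ℂ W).comp ρ

theorem character_transport {V W : Type*} [AddCommGroup V] [Module ℂ V] [AddCommGroup W]
    [Module ℂ W] (ρ : Representation ℂ G V) (e : V ≃ₗ[ℂ] W) :
    (transport ρ e).character = ρ.character :=
  funext fun g => LinearMap.trace_conj' (ρ g) e

/-- `IsChar` asks for a space in `Type`; a basis moves a representation from any universe to ℂⁿ. -/
theorem isChar_character {V : Type*} [AddCommGroup V] [Module ℂ V] [FiniteDimensional ℂ V]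
    (ρ : Representation ℂ G V) : IsChar ρ.character :=
  ⟨Fin (Module.finrank ℂ V) → ℂ, inferInstance, inferInstance, inferInstance,
    transport ρ (Module.finBasis ℂ V).equivFun, character_transport ρ _⟩

theorem IsChar.comp {χ : G → ℂ} (h : IsChar χ) {G' : Type*} [Group G'] (f : G' →* G) :
    IsChar (fun g => χ (f g)) := by
  obtain ⟨V, _, _, _, ρ, rfl⟩ := h
  exact isChar_character (ρ.comp f : Representation ℂ G' V)

theorem IsChar.restrict {χ : G → ℂ} (h : IsChar χ) (H : Subgroup G) : IsChar (res H χ) :=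
  h.comp H.subtype

theorem IsChar.restrictLE {K H : Subgroup G} (hKH : K ≤ H) {χ : H → ℂ} (h : IsChar χ) :
    IsChar (resLE hKH χ) :=
  h.comp (Subgroup.inclusion hKH)

theorem IsChar.mul {χ ψ : G → ℂ} (hχ : IsChar χ) (hψ : IsChar ψ) : IsChar (χ * ψ) := by
  obtain ⟨V, _, _, _, ρ, rfl⟩ := hχ
  obtain ⟨W, _, _, _, σ, rfl⟩ := hψ
  rw [← Representation.char_tensor]
  exact isChar_character _

theorem IsChar.conj {χ : G → ℂ} (h : IsChar χ) (x g : G) : χ (x * g * x⁻¹) = χ g := by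
  obtain ⟨V, _, _, _, ρ, rfl⟩ := h
  exact ρ.char_conj g x

/-! ### Inner products and constituents -/

-- Averaging gives an invariant positive definite form P, which makes A(g)ᴴ similar to A(g⁻¹).
open Matrix ComplexOrder in
theorem star_trace_eq_trace_inv [Finite G] {n : ℕ} (A : G →* Matrix (Fin n) (Fin n) ℂ) (g : G) :
    star (A g).trace = (A g⁻¹).trace := by
  classical
  cases nonempty_fintype G
  let P : Matrix (Fin n) (Fin n) ℂ := ∑ x : G, (A x)ᴴ * A x
  have hP : P.PosDef := by
    have : P = (A 1)ᴴ * A 1 + ∑ x ∈ Finset.univ.erase 1, (A x)ᴴ * A x :=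
      (Finset.add_sum_erase _ _ (Finset.mem_univ 1)).symm
    rw [this]
    refine PosDef.add_posSemidef (by simpa using PosDef.one) ?_
    exact posSemidef_sum _ fun x _ => posSemidef_conjTranspose_mul_self (A x)
  have hinv : (A g)ᴴ * P * A g = P := by
    simp only [P, Finset.mul_sum, Finset.sum_mul]
    refine Fintype.sum_equiv (Equiv.mulRight g) _ _ fun x => ?_
    simp [Matrix.mul_assoc, conjTranspose_mul]
  have hAg : A g * A g⁻¹ = 1 := by rw [← map_mul, mul_inv_cancel, map_one]
  have h1 : (A g)ᴴ * P = P * A g⁻¹ := by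
    rw [← hinv, Matrix.mul_assoc ((A g)ᴴ * P), hAg, Matrix.mul_one, hinv]
  have hu : IsUnit P.det := (isUnit_iff_isUnit_det P).1 hP.isUnit
  have h2 : A g⁻¹ = P⁻¹ * ((A g)ᴴ * P) := by
    rw [h1, ← Matrix.mul_assoc, nonsing_inv_mul _ hu, Matrix.one_mul]
  rw [h2, trace_mul_comm, Matrix.mul_assoc, mul_nonsing_inv _ hu, Matrix.mul_one,
    trace_conjTranspose]

theorem IsChar.conj_eq_inv [Finite G] {χ : G → ℂ} (h : IsChar χ) (g : G) :
    starRingEnd ℂ (χ g) = χ g⁻¹ := by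
  obtain ⟨V, _, _, _, ρ, rfl⟩ := h
  let b := Module.finBasis ℂ V
  simp only [Representation.character, LinearMap.trace_eq_matrix_trace ℂ b]
  exact star_trace_eq_trace_inv
    ((LinearMap.toMatrixAlgEquiv b : Module.End ℂ V →*
      Matrix (Fin (Module.finrank ℂ V)) (Fin (Module.finrank ℂ V)) ℂ).comp ρ) g

theorem inner_eq_sum [Fintype G] (α β : G → ℂ) :
    inner α β = (Nat.card G : ℂ)⁻¹ * ∑ g : G, α g * starRingEnd ℂ (β g) := by
  rw [inner, finsum_eq_sum_of_fintype]

theorem inner_character [Finite G] {V W : Type} [AddCommGroup V] [Module ℂ V]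
    [FiniteDimensional ℂ V] [AddCommGroup W] [Module ℂ W] [FiniteDimensional ℂ W]
    (ρ : Representation ℂ G V) (σ : Representation ℂ G W) :
    inner σ.character ρ.character = Module.finrank ℂ (Representation.IntertwiningMap ρ σ) := by
  cases nonempty_fintype G
  have : Invertible (Nat.card G : ℂ) := invertibleOfNonzero (by simp)
  rw [← Representation.card_inv_mul_sum_char_mul_char_eq_finrank, inner_eq_sum]
  simp_rw [(isChar_character ρ).conj_eq_inv]

theorem IsChar.exists_inner_eq_natCast [Finite G] {α β : G → ℂ} (hα : IsChar α) (hβ : IsChar β) :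
    ∃ n : ℕ, inner α β = n := by
  obtain ⟨V, _, _, _, ρ, rfl⟩ := hα
  obtain ⟨W, _, _, _, σ, rfl⟩ := hβ
  exact ⟨_, inner_character σ ρ⟩

theorem exists_intertwiningMap_ne_zero [Finite G] {V W : Type} [AddCommGroup V] [Module ℂ V]
    [FiniteDimensional ℂ V] [AddCommGroup W] [Module ℂ W] [FiniteDimensional ℂ W]
    {ρ : Representation ℂ G V} {σ : Representation ℂ G W}
    (h : inner σ.character ρ.character ≠ 0) : ∃ f : Representation.IntertwiningMap ρ σ, f ≠ 0 := by
  rw [inner_character] at h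
  by_contra! h0
  have : Subsingleton (Representation.IntertwiningMap ρ σ) :=
    ⟨fun f g => (h0 f).trans (h0 g).symm⟩
  exact h (by simp [Module.finrank_zero_of_subsingleton])

theorem inner_comm [Finite G] (α β : G → ℂ) : starRingEnd ℂ (inner α β) = inner β α := by
  cases nonempty_fintype G
  simp [inner_eq_sum, mul_comm]

theorem inner_ne_zero_comm [Finite G] {α β : G → ℂ} : inner α β ≠ 0 ↔ inner β α ≠ 0 := by
  rw [← inner_comm β α]
  simp

theorem inner_sum_left [Finite G] {ι : Type*} (s : Finset ι) (α : ι → G → ℂ) (β : G → ℂ) :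
    inner (∑ i ∈ s, α i) β = ∑ i ∈ s, inner (α i) β := by
  cases nonempty_fintype G
  simp only [inner_eq_sum, Finset.sum_apply, Finset.sum_mul, ← Finset.mul_sum]
  rw [Finset.sum_comm]

/-- Schur's lemma: a nonzero intertwining map between irreducibles is an isomorphism. -/
theorem inner_irr [Finite G] (χ φ : Irr G) : inner χ.1 φ.1 ≠ 0 ↔ χ = φ := by
  constructor
  · obtain ⟨_, V, _, _, _, ρ, hρ, rfl⟩ := χ
    obtain ⟨_, W, _, _, _, σ, hσ, rfl⟩ := φ
    intro h
    obtain ⟨f, hf⟩ := exists_intertwiningMap_ne_zero h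
    have hb := (Representation.IsIrreducible.bijective_or_eq_zero f).resolve_right hf
    exact Subtype.ext (Representation.char_iso (f.ofBijective hb)).symm
  · rintro rfl
    obtain ⟨_, V, _, _, _, ρ, hρ, rfl⟩ := χ
    simp [inner_character]

theorem character_eq_add_of_isCompl {V : Type*} [AddCommGroup V] [Module ℂ V]
    [FiniteDimensional ℂ V] {ρ : Representation ℂ G V} {S T : Subrepresentation ρ}
    (h : IsCompl S.toSubmodule T.toSubmodule) :
    ρ.character = S.toRepresentation.character + T.toRepresentation.character := by
  have e : Representation.Equiv (S.toRepresentation.prod T.toRepresentation) ρ :=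
    .mk (Submodule.prodEquivOfIsCompl _ _ h) fun g => by
      ext x <;> simp [Subrepresentation.toRepresentation]
  rw [← Representation.char_iso e]
  ext g
  exact LinearMap.trace_prodMap' _ _

theorem exists_character_eq_sum [Finite G] (n : ℕ) {V : Type} [AddCommGroup V] [Module ℂ V]
    [FiniteDimensional ℂ V] (ρ : Representation ℂ G V) (hn : Module.finrank ℂ V = n) :
    ∃ (ι : Type) (_ : Fintype ι) (φ : ι → Irr G), ρ.character = ∑ i, (φ i).1 := by
  induction n using Nat.strong_induction_on generalizing V with
  | _ n ih =>
    rcases subsingleton_or_nontrivial V with hV | hV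
    · refine ⟨Empty, inferInstance, Empty.elim, ?_⟩
      ext g
      simp [Representation.character, Subsingleton.elim (ρ g) 0]
    by_cases hρ : ρ.IsIrreducible
    · exact ⟨Unit, inferInstance, fun _ => ⟨_, V, _, _, ‹_›, ρ, hρ, rfl⟩, by simp⟩
    have hnt : Nontrivial (Subrepresentation ρ) :=
      ⟨⊥, ⊤, fun h => bot_ne_top (α := Submodule ℂ V)
        (congrArg Subrepresentation.toSubmodule h)⟩
    obtain ⟨S, hS0, hS1⟩ : ∃ S : Subrepresentation ρ, S ≠ ⊥ ∧ S ≠ ⊤ := by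
      by_contra! h
      exact hρ ⟨fun S => or_iff_not_imp_left.2 (h S)⟩
    -- Maschke's theorem.
    have : ComplementedLattice (Subrepresentation ρ) :=
      inferInstanceAs (Representation.IsSemisimpleRepresentation ρ)
    obtain ⟨T, hT⟩ := exists_isCompl S
    have hST : IsCompl S.toSubmodule T.toSubmodule :=
      ⟨disjoint_iff.2 (congrArg Subrepresentation.toSubmodule hT.inf_eq_bot),
        codisjoint_iff.2 (congrArg Subrepresentation.toSubmodule hT.sup_eq_top)⟩
    have hS0' : S.toSubmodule ≠ ⊥ := fun h => hS0 (Subrepresentation.toSubmodule_injective h)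
    have hS1' : S.toSubmodule ≠ ⊤ := fun h => hS1 (Subrepresentation.toSubmodule_injective h)
    have hT1 : T.toSubmodule ≠ ⊤ := fun h => hS0' (by simpa [h] using hST.inf_eq_bot)
    obtain ⟨ι, _, φ, hφ⟩ := ih _ (hn ▸ Submodule.finrank_lt hS1') S.toRepresentation rfl
    obtain ⟨κ, _, ψ, hψ⟩ := ih _ (hn ▸ Submodule.finrank_lt hT1) T.toRepresentation rfl
    refine ⟨ι ⊕ κ, inferInstance, Sum.elim φ ψ, ?_⟩
    rw [character_eq_add_of_isCompl hST, hφ, hψ]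
    simp

theorem IsChar.exists_eq_sum [Finite G] {χ : G → ℂ} (h : IsChar χ) :
    ∃ (ι : Type) (_ : Fintype ι) (φ : ι → Irr G), χ = ∑ i, (φ i).1 := by
  obtain ⟨V, _, _, _, ρ, rfl⟩ := h
  exact exists_character_eq_sum _ ρ rfl

/-- Inner products of characters are natural numbers, so no cancellation can occur in the sum. -/
theorem inner_sum_ne_zero_iff [Finite G] {ι : Type*} [Fintype ι] {α : ι → G → ℂ} {β : G → ℂ}
    (hα : ∀ i, IsChar (α i)) (hβ : IsChar β) :
    inner (∑ i, α i) β ≠ 0 ↔ ∃ i, inner (α i) β ≠ 0 := by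
  choose m hm using fun i => (hα i).exists_inner_eq_natCast hβ
  rw [inner_sum_left]
  simp only [hm]
  rw [← Nat.cast_sum, Nat.cast_ne_zero]
  simp [Finset.sum_eq_zero_iff]

/-- Two characters have nonzero inner product iff they share an irreducible constituent. -/
theorem IsChar.inner_ne_zero_iff [Finite G] {α β : G → ℂ} (hα : IsChar α) (hβ : IsChar β) :
    inner α β ≠ 0 ↔ ∃ φ : Irr G, inner α φ.1 ≠ 0 ∧ inner β φ.1 ≠ 0 := by
  obtain ⟨ι, _, a, rfl⟩ := hα.exists_eq_sum
  rw [inner_sum_ne_zero_iff (fun i => (a i).isChar) hβ]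
  simp only [inner_sum_ne_zero_iff (fun i => (a i).isChar) (Irr.isChar _), inner_irr]
  constructor
  · rintro ⟨i, hi⟩
    exact ⟨a i, ⟨i, rfl⟩, inner_ne_zero_comm.1 hi⟩
  · rintro ⟨_, ⟨i, rfl⟩, hi⟩
    exact ⟨i, inner_ne_zero_comm.1 hi⟩

/-- If `φ` is a constituent of `α`, then constituents of the restriction of `φ` are constituents
of the restriction of `α`. -/
theorem IsChar.inner_comp_ne_zero [Finite G] {G' : Type*} [Group G'] [Finite G'] (f : G' →* G)
    {α : G → ℂ} (hα : IsChar α) {β : G' → ℂ} (hβ : IsChar β) {φ : Irr G}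
    (h : inner α φ.1 ≠ 0) (h' : inner (fun g => φ.1 (f g)) β ≠ 0) :
    inner (fun g => α (f g)) β ≠ 0 := by
  obtain ⟨ι, _, a, rfl⟩ := hα.exists_eq_sum
  rw [inner_sum_ne_zero_iff (fun i => (a i).isChar) φ.isChar] at h
  obtain ⟨i, hi⟩ := h
  obtain rfl := (inner_irr _ _).1 hi
  have : (fun g => (∑ i, (a i).1) (f g)) = ∑ i, fun g => (a i).1 (f g) := by
    ext g
    simp
  rw [this, inner_sum_ne_zero_iff (fun i => (a i).isChar.comp f) hβ]
  exact ⟨i, h'⟩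

/-- If `β` is a constituent of the restriction of `α`, then it is one of the restriction of a
constituent of `α`. -/
theorem IsChar.exists_irr_of_inner_comp_ne_zero [Finite G] {G' : Type*} [Group G'] [Finite G']
    (f : G' →* G) {α : G → ℂ} (hα : IsChar α) {β : G' → ℂ} (hβ : IsChar β)
    (h : inner (fun g => α (f g)) β ≠ 0) :
    ∃ φ : Irr G, inner α φ.1 ≠ 0 ∧ inner (fun g => φ.1 (f g)) β ≠ 0 := by
  obtain ⟨ι, _, a, rfl⟩ := hα.exists_eq_sum
  have : (fun g => (∑ i, (a i).1) (f g)) = ∑ i, fun g => (a i).1 (f g) := by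
    ext g
    simp
  rw [this, inner_sum_ne_zero_iff (fun i => (a i).isChar.comp f) hβ] at h
  obtain ⟨i, hi⟩ := h
  refine ⟨a i, ?_, hi⟩
  rw [inner_sum_ne_zero_iff (fun i => (a i).isChar) (a i).isChar]
  exact ⟨i, (inner_irr _ _).2 rfl⟩

theorem Irr.one_ne_zero (χ : Irr G) : χ.1 1 ≠ 0 := by
  obtain ⟨_, V, _, _, _, ρ, hρ, rfl⟩ := χ
  have : Nontrivial V := by
    by_contra! h
    obtain ⟨S, T, hST⟩ := hρ.toNontrivial
    exact hST (Subrepresentation.toSubmodule_injective (Subsingleton.elim _ _))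
  simpa using (Module.finrank_pos (R := ℂ) (M := V)).ne'

theorem IsChar.inner_self_ne_zero [Finite G] {χ : G → ℂ} (hχ : IsChar χ) (h1 : χ 1 ≠ 0) :
    inner χ χ ≠ 0 := by
  rw [hχ.inner_ne_zero_iff hχ]
  simp only [and_self]
  obtain ⟨ι, _, a, rfl⟩ := hχ.exists_eq_sum
  have : Nonempty ι := by
    by_contra! h
    simp at h1
  exact ⟨a Classical.ofNonempty,
    (inner_sum_ne_zero_iff (fun i => (a i).isChar) (Irr.isChar _)).2 ⟨_, (inner_irr _ _).2 rfl⟩⟩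

theorem IsChar.exists_inner_ne_zero [Finite G] {χ : G → ℂ} (hχ : IsChar χ) (h1 : χ 1 ≠ 0) :
    ∃ φ : Irr G, inner χ φ.1 ≠ 0 := by
  obtain ⟨φ, h, -⟩ := (hχ.inner_ne_zero_iff hχ).1 (hχ.inner_self_ne_zero h1)
  exact ⟨φ, h⟩

/-! ### The permutation character -/

/-- The permutation character of `G` on the cosets of `H`. -/
noncomputable def permChar (H : Subgroup G) (g : G) : ℂ :=
  Nat.card {q : G ⧸ H // g • q = q}

theorem isChar_permChar [Finite G] (H : Subgroup G) : IsChar (permChar H) := by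
  classical
  cases nonempty_fintype (G ⧸ H)
  let ρ : Representation ℂ G (G ⧸ H → ℂ) :=
    { toFun := fun g => LinearMap.funLeft ℂ ℂ (g⁻¹ • · : G ⧸ H → G ⧸ H)
      map_one' := by ext; simp [LinearMap.funLeft]
      map_mul' := fun x y => by ext; simp [LinearMap.funLeft, mul_smul] }
  convert! isChar_character ρ
  ext g
  rw [Representation.character, LinearMap.trace_eq_matrix_trace ℂ (Pi.basisFun ℂ _), permChar,
    Nat.card_eq_fintype_card, Fintype.card_subtype]
  simp [Matrix.trace, ρ, LinearMap.funLeft, Pi.single_apply, inv_smul_eq_iff,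
    eq_comm (a := g • (_ : G ⧸ H))]

/-- An element fixing every coset is in the kernel of the action on G/H, which is the core. -/
theorem permChar_eq_index_iff [Finite G] (H : Subgroup G) (g : G) :
    permChar H g = Nat.card (G ⧸ H) ↔ g ∈ H.normalCore := by
  rw [permChar, Nat.cast_inj, Subgroup.normalCore_eq_ker, MonoidHom.mem_ker, Equiv.ext_iff]
  constructor
  · intro h q
    have hb := (Nat.bijective_iff_injective_and_card
      (Subtype.val : {q : G ⧸ H // g • q = q} → G ⧸ H)).2 ⟨Subtype.val_injective, h⟩
    obtain ⟨q', rfl⟩ := hb.2 q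
    exact q'.2
  · intro h
    exact Nat.card_congr (Equiv.subtypeUnivEquiv h)

/-- Frobenius reciprocity in the form `[α · 1_H^G, β] = [α_H, β_H]`. -/
theorem IsChar.inner_mul_permChar [Finite G] {α β : G → ℂ} (hα : IsChar α) (hβ : IsChar β)
    (H : Subgroup G) : inner (α * permChar H) β = inner (res H α) (res H β) := by
  classical
  cases nonempty_fintype G
  cases nonempty_fintype (G ⧸ H)
  cases nonempty_fintype H
  -- The stabilizer of xH is xHx⁻¹; conjugating by x carries the sum to H, as α and β are class
  -- functions.
  have hq (q : G ⧸ H) : ∑ g : G, (if g • q = q then α g * starRingEnd ℂ (β g) else 0) =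
      ∑ h : H, α h * starRingEnd ℂ (β h) := by
    obtain ⟨x, rfl⟩ := QuotientGroup.mk_surjective q
    rw [← (MulAut.conj x).toEquiv.sum_comp]
    simp only [MulEquiv.toEquiv_eq_coe, EquivLike.coe_coe, MulAut.conj_apply, hα.conj, hβ.conj,
      MulAction.Quotient.smul_mk, smul_eq_mul, inv_mul_cancel_right, QuotientGroup.eq]
    rw [← Finset.sum_filter]
    refine (Finset.sum_subtype _ (fun g => ?_) _)
    simp [mul_inv_rev, mul_assoc]
  have hp (g : G) : permChar H g = ∑ q : G ⧸ H, if g • q = q then (1 : ℂ) else 0 := by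
    rw [permChar, Nat.card_eq_fintype_card, Fintype.card_subtype]
    simp
  have hs : ∑ g : G, (α * permChar H) g * starRingEnd ℂ (β g) =
      Nat.card (G ⧸ H) * ∑ h : H, α h * starRingEnd ℂ (β h) := by
    calc _ = ∑ g : G, ∑ q : G ⧸ H, if g • q = q then α g * starRingEnd ℂ (β g) else 0 := by
          refine Finset.sum_congr rfl fun g _ => ?_
          rw [Pi.mul_apply, hp, mul_right_comm, Finset.mul_sum]
          simp
      _ = _ := by
          rw [Finset.sum_comm, Finset.sum_congr rfl fun q _ => hq q]
          simp
  have hG : (Nat.card (G ⧸ H) : ℂ) ≠ 0 := by simp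
  rw [inner_eq_sum, inner_eq_sum, hs, H.card_eq_card_quotient_mul_card_subgroup, Nat.cast_mul,
    mul_inv]
  field_simp
  rfl

end

section

variable {G : Type*} [Group G] [Finite G]

theorem inner_ne_zero_of_intertwiningMap {V W : Type} [AddCommGroup V] [Module ℂ V]
    [FiniteDimensional ℂ V] [AddCommGroup W] [Module ℂ W] [FiniteDimensional ℂ W]
    {ρ : Representation ℂ G V} {σ : Representation ℂ G W}
    {f : Representation.IntertwiningMap ρ σ} (hf : f ≠ 0) :
    inner σ.character ρ.character ≠ 0 := by
  have : Nontrivial (Representation.IntertwiningMap ρ σ) := ⟨f, 0, hf⟩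
  rw [inner_character, Nat.cast_ne_zero]
  exact Module.finrank_pos.ne'

/-! ### Clifford theory and characters above a subgroup -/

omit [Finite G] in
theorem orbitOf_eq_iff {K : Subgroup G} [K.Normal] {θ θ' : Irr K} :
    orbitOf θ = orbitOf θ' ↔ ∃ g : G, g • θ' = θ :=
  Quotient.eq.trans MulAction.orbitRel_apply

/-- Clifford's theorem: the constituents of the restriction of an irreducible character to a normal
subgroup are conjugate. -/
theorem orbitOf_eq_of_inner_ne_zero {K : Subgroup G} [K.Normal] {χ : Irr G} {θ θ' : Irr K}
    (h : inner (res K χ.1) θ.1 ≠ 0) (h' : inner (res K χ.1) θ'.1 ≠ 0) :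
    orbitOf θ = orbitOf θ' := by
  suffices ∃ g : G, g⁻¹ • θ' = θ from
    orbitOf_eq_iff.2 (this.imp' (·⁻¹) fun g hg => hg)
  obtain ⟨_, V, _, _, _, ρ, hρ, rfl⟩ := χ
  have hθ := θ.2
  have hθ' := θ'.2
  obtain ⟨W, _, _, _, σ, hσ, hσθ⟩ := hθ
  obtain ⟨W', _, _, _, σ', hσ', hσθ'⟩ := hθ'
  rw [← hσθ] at h
  rw [inner_ne_zero_comm, ← hσθ'] at h'
  let ρK : Representation ℂ K V := ρ.comp K.subtype
  obtain ⟨f, hf⟩ := exists_intertwiningMap_ne_zero (ρ := σ) (σ := ρK) h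
  obtain ⟨p, hp⟩ := exists_intertwiningMap_ne_zero (ρ := ρK) (σ := σ') h'
  -- The largest G-invariant subspace of ker p. It is zero by irreducibility, so some translate of
  -- f(w) escapes ker p.
  let S : Subrepresentation ρ :=
    { toSubmodule := ⨅ g : G, LinearMap.ker (p.toLinearMap ∘ₗ ρ g)
      apply_mem_toSubmodule := fun g v hv => by
        simp only [Submodule.mem_iInf, LinearMap.mem_ker, LinearMap.comp_apply] at hv ⊢
        intro x
        rw [← Module.End.mul_apply, ← map_mul]
        exact hv (x * g) }
  have hmem (v : V) : v ∈ S.toSubmodule ↔ ∀ g, p (ρ g v) = 0 := by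
    simp [S, Submodule.mem_iInf]
  have hS : S = ⊥ := by
    refine (hρ.eq_bot_or_eq_top S).resolve_right fun hS => hp ?_
    ext v
    have hv : v ∈ S.toSubmodule := by
      rw [hS]
      exact Submodule.mem_top (R := ℂ)
    simpa using (hmem v).1 hv 1
  obtain ⟨w, hw⟩ : ∃ w, f w ≠ 0 := by
    by_contra! h0
    exact hf (by ext w; exact h0 w)
  obtain ⟨g, hg⟩ : ∃ g, p (ρ g (f w)) ≠ 0 := by
    by_contra! h0
    have := (hmem _).2 h0
    rw [hS] at this
    exact hw ((Submodule.mem_bot ℂ).1 this)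
  refine ⟨g, ((inner_irr _ _).1 ?_)⟩
  let τ : Representation ℂ K W' := σ'.comp (MulAut.conjNormal g : K ≃* K).toMonoidHom
  have hτ : (g⁻¹ • θ').1 = τ.character := by
    ext k
    change θ'.1 (MulAut.conjNormal g⁻¹⁻¹ k) = _
    rw [← hσθ', inv_inv]
    rfl
  -- p ∘ ρ(g) ∘ f is K-equivariant once σ' is twisted by conjugation by g.
  let T : Representation.IntertwiningMap σ τ :=
    (p.toLinearMap ∘ₗ ρ g ∘ₗ f.toLinearMap).intertwiningMap_of_isIntertwiningMap σ τ
      fun k w => by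
        change p (ρ g (f (σ k w))) = σ' (MulAut.conjNormal g k) (p (ρ g (f w)))
        rw [f.isIntertwining, ← p.isIntertwining]
        change p (ρ g (ρ k (f w))) = p (ρ (g * k * g⁻¹) (ρ g (f w)))
        rw [← Module.End.mul_apply, ← Module.End.mul_apply, ← map_mul, ← map_mul,
          inv_mul_cancel_right]
  rw [hτ, ← hσθ]
  exact inner_ne_zero_of_intertwiningMap (f := T) fun h0 => hg (congr($h0 w))

theorem inner_res_smul {K : Subgroup G} [K.Normal] {χ : G → ℂ} (hχ : IsChar χ) (θ : Irr K)
    (g : G) : inner (res K χ) (g • θ).1 = inner (res K χ) θ.1 := by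
  cases nonempty_fintype K
  rw [inner_eq_sum, inner_eq_sum]
  congr 1
  refine Fintype.sum_equiv (MulAut.conjNormal g⁻¹ : K ≃* K).toEquiv _ _ fun k => ?_
  have : res K χ k = res K χ (MulAut.conjNormal g⁻¹ k) := by
    simp only [res, MulAut.conjNormal_apply, hχ.conj]
  rw [this]
  rfl

theorem orbitOf_eq_iff_inner_ne_zero {K : Subgroup G} [K.Normal] {χ : Irr G} {θ θ' : Irr K}
    (h : inner (res K χ.1) θ.1 ≠ 0) :
    orbitOf θ = orbitOf θ' ↔ inner (res K χ.1) θ'.1 ≠ 0 := by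
  refine ⟨fun ho => ?_, orbitOf_eq_of_inner_ne_zero h⟩
  obtain ⟨g, rfl⟩ := orbitOf_eq_iff.1 ho
  rwa [inner_res_smul χ.isChar] at h

theorem Irr.exists_inner_res_ne_zero (χ : Irr G) (K : Subgroup G) :
    ∃ θ : Irr K, inner (res K χ.1) θ.1 ≠ 0 :=
  (χ.isChar.restrict K).exists_inner_ne_zero χ.one_ne_zero

-- This is the regular character: translation by g ≠ 1 has no fixed point.
omit [Finite G] in
theorem permChar_bot (g : G) [Decidable (g = 1)] :
    permChar (⊥ : Subgroup G) g = if g = 1 then (Nat.card G : ℂ) else 0 := by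
  have e : {q : G ⧸ (⊥ : Subgroup G) // g • q = q} ≃ {x : G // g * x = x} :=
    (QuotientGroup.quotientBot.symm.toEquiv.subtypeEquiv fun x => by
      change _ ↔ ((g * x : G) : G ⧸ (⊥ : Subgroup G)) = (x : G ⧸ (⊥ : Subgroup G))
      rw [QuotientGroup.eq, Subgroup.mem_bot, inv_mul_eq_one]).symm
  rw [permChar, Nat.card_congr e]
  split_ifs with h
  · simp [h]
  · simp [h]

theorem inner_permChar_bot (α : G → ℂ) : inner α (permChar ⊥) = α 1 := by
  classical
  cases nonempty_fintype G
  rw [inner_eq_sum]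
  simp [permChar_bot, apply_ite (starRingEnd ℂ), mul_comm (α 1)]

/-- Every irreducible character of a subgroup lies under an irreducible character. -/
theorem Irr.exists_inner_res_ne_zero_left {K : Subgroup G} (θ : Irr K) :
    ∃ χ : Irr G, inner (res K χ.1) θ.1 ≠ 0 := by
  classical
  refine ((isChar_permChar (⊥ : Subgroup G)).exists_irr_of_inner_comp_ne_zero K.subtype
    θ.isChar ?_).imp fun χ h => h.2
  -- The regular character of G restricts to |G:K| times that of K, which contains every θ.
  have : (fun k : K => permChar (⊥ : Subgroup G) (K.subtype k)) =
      fun k => K.index * permChar (⊥ : Subgroup K) k := by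
    ext k
    rw [permChar_bot, permChar_bot, ← K.index_mul_card]
    simp
  cases nonempty_fintype K
  rw [inner_ne_zero_comm, this]
  have h2 : inner θ.1 (fun k => K.index * permChar (⊥ : Subgroup K) k) =
      K.index * inner θ.1 (permChar ⊥) := by
    simp only [inner_eq_sum, map_mul, map_natCast, Finset.mul_sum]
    exact Finset.sum_congr rfl fun k _ => by ring
  rw [h2, inner_permChar_bot]
  exact mul_ne_zero (Nat.cast_ne_zero.2 K.index_ne_zero_of_finite) θ.one_ne_zero

/-! ### Reachability through powers of the permutation character -/

theorem reachable_of_inner_mul_permChar_pow (H : Subgroup G) (n : ℕ) (χ χ' : Irr G)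
    (h : inner (χ.1 * permChar H ^ n) χ'.1 ≠ 0) :
    (graph H).Reachable (Sum.inl χ) (Sum.inl χ') := by
  have hc (n : ℕ) : IsChar (χ.1 * permChar H ^ n) := by
    induction n with
    | zero => simpa using χ.isChar
    | succ n ih =>
      rw [pow_succ, ← mul_assoc]
      exact ih.mul (isChar_permChar H)
  induction n generalizing χ' with
  | zero =>
    rw [pow_zero, mul_one, inner_irr] at h
    rw [h]
  | succ n ih =>
    rw [pow_succ, ← mul_assoc, (hc n).inner_mul_permChar χ'.isChar,
      ((hc n).restrict H).inner_ne_zero_iff (χ'.isChar.restrict H)] at h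
    obtain ⟨φ, h1, h2⟩ := h
    obtain ⟨ψ, h3, h4⟩ := (hc n).exists_irr_of_inner_comp_ne_zero H.subtype φ.isChar h1
    have a1 : (graph H).Adj (Sum.inl ψ) (Sum.inr φ) := h4
    have a2 : (graph H).Adj (Sum.inr φ) (Sum.inl χ') := h2
    exact (ih ψ h3).trans (a1.reachable.trans a2.reachable)

/-- If a function is orthogonal to all powers of the permutation character on the cosets of `H`,
then its sum over the normal core of `H` vanishes. -/
theorem sum_normalCore_eq_zero [Fintype G] (H : Subgroup G) [Fintype H.normalCore] (a : G → ℂ)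
    (h : ∀ n : ℕ, ∑ g, a g * permChar H g ^ n = 0) : ∑ k : H.normalCore, a k = 0 := by
  classical
  have hP (P : Polynomial ℂ) : ∑ g, a g * P.eval (permChar H g) = 0 := by
    simp only [Polynomial.eval_eq_sum_range, Finset.mul_sum]
    rw [Finset.sum_comm]
    refine Finset.sum_eq_zero fun n _ => ?_
    rw [← mul_zero (P.coeff n), ← h n, Finset.mul_sum]
    exact Finset.sum_congr rfl fun g _ => by ring
  let s : Finset G := {g | g ∉ H.normalCore}
  -- P kills the values of π off the core but not |G:H|, its value on the core.
  let P : Polynomial ℂ := ∏ g ∈ s, (Polynomial.X - Polynomial.C (permChar H g))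
  have hc : P.eval (Nat.card (G ⧸ H) : ℂ) ≠ 0 := by
    simp only [P, Polynomial.eval_prod, Finset.prod_ne_zero_iff]
    intro g hg
    simp only [Polynomial.eval_sub, Polynomial.eval_X, Polynomial.eval_C, sub_ne_zero]
    exact fun h => (Finset.mem_filter.1 hg).2 ((permChar_eq_index_iff H g).1 h.symm)
  have h0 : ∑ g, a g * P.eval (permChar H g) =
      ∑ k : H.normalCore, a k * P.eval (Nat.card (G ⧸ H) : ℂ) := by
    rw [← Finset.sum_subset (Finset.subset_univ ({g | g ∈ H.normalCore} : Finset G))]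
    · rw [Finset.sum_subtype _ (p := (· ∈ H.normalCore)) (fun g => by simp)]
      exact Finset.sum_congr rfl fun k _ => by rw [(permChar_eq_index_iff H _).2 k.2]
    · intro g _ hg
      have hgs : g ∈ s := by simpa [s] using hg
      rw [Polynomial.eval_prod, Finset.prod_eq_zero hgs (by simp), mul_zero]
  rw [hP, ← Finset.sum_mul] at h0
  exact (mul_eq_zero.1 h0.symm).resolve_right hc

/-- Irreducible characters whose restrictions to the normal core of `H` share a constituent are
connected in the Frobenius graph. -/
theorem reachable_of_inner_res_normalCore (H : Subgroup G) {χ χ' : Irr G}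
    {θ : Irr H.normalCore} (h : inner (res H.normalCore χ.1) θ.1 ≠ 0)
    (h' : inner (res H.normalCore χ'.1) θ.1 ≠ 0) :
    (graph H).Reachable (Sum.inl χ) (Sum.inl χ') := by
  cases nonempty_fintype G
  cases nonempty_fintype H.normalCore
  have hne : inner (res H.normalCore χ.1) (res H.normalCore χ'.1) ≠ 0 :=
    ((χ.isChar.restrict _).inner_ne_zero_iff (χ'.isChar.restrict _)).2 ⟨θ, h, h'⟩
  by_contra hr
  refine hne ?_
  rw [inner_eq_sum]
  refine mul_eq_zero_of_right _ (sum_normalCore_eq_zero H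
    (fun g => χ.1 g * starRingEnd ℂ (χ'.1 g)) fun n => ?_)
  have hn : inner (χ.1 * permChar H ^ n) χ'.1 = 0 :=
    not_not.1 (mt (reachable_of_inner_mul_permChar_pow H n χ χ') hr)
  rw [inner_eq_sum] at hn
  rw [← (mul_eq_zero.1 hn).resolve_left (by simp)]
  exact Finset.sum_congr rfl fun g _ => by simp only [Pi.mul_apply, Pi.pow_apply]; ring

theorem inner_res_ne_zero_of_adj {H : Subgroup G} {χ : Irr G} {φ : Irr H}
    {θ : Irr H.normalCore} (h : inner (res H χ.1) φ.1 ≠ 0)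
    (h' : inner (resLE H.normalCore_le φ.1) θ.1 ≠ 0) :
    inner (res H.normalCore χ.1) θ.1 ≠ 0 :=
  (χ.isChar.restrict H).inner_comp_ne_zero (Subgroup.inclusion H.normalCore_le) θ.isChar h h'

theorem Irr.exists_inner_resLE_ne_zero {K H : Subgroup G} (hKH : K ≤ H) (φ : Irr H) :
    ∃ θ : Irr K, inner (resLE hKH φ.1) θ.1 ≠ 0 :=
  (φ.isChar.restrictLE hKH).exists_inner_ne_zero (by simpa [resLE] using φ.one_ne_zero)

/-! ### The bijection between components and orbits -/

/-- The orbit of irreducible characters of the normal core of `H` lying under a vertex of the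
Frobenius graph. -/
noncomputable def orbitUnder (H : Subgroup G) : Irr G ⊕ Irr H → Orbits H.normalCore
  | .inl χ => orbitOf (χ.exists_inner_res_ne_zero H.normalCore).choose
  | .inr φ => orbitOf (φ.exists_inner_resLE_ne_zero H.normalCore_le).choose

/-- By Clifford's theorem the chosen constituent does not matter. -/
theorem orbitUnder_inl_eq_iff (H : Subgroup G) (χ : Irr G) (θ : Irr H.normalCore) :
    orbitUnder H (Sum.inl χ) = orbitOf θ ↔ inner (res H.normalCore χ.1) θ.1 ≠ 0 :=
  orbitOf_eq_iff_inner_ne_zero (χ.exists_inner_res_ne_zero H.normalCore).choose_spec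

theorem orbitUnder_inl_eq_inr {H : Subgroup G} {χ : Irr G} {φ : Irr H}
    (h : inner (res H χ.1) φ.1 ≠ 0) :
    orbitUnder H (Sum.inl χ) = orbitUnder H (Sum.inr φ) :=
  (orbitUnder_inl_eq_iff H χ _).2 (inner_res_ne_zero_of_adj h
    (φ.exists_inner_resLE_ne_zero H.normalCore_le).choose_spec)

theorem orbitUnder_eq_of_adj {H : Subgroup G} {v w : Irr G ⊕ Irr H} (h : (graph H).Adj v w) :
    orbitUnder H v = orbitUnder H w := by
  rcases v with χ | φ <;> rcases w with χ' | φ'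
  · exact h.elim
  · exact orbitUnder_inl_eq_inr h
  · exact (orbitUnder_inl_eq_inr h).symm
  · exact h.elim

/-- The map from the components of the Frobenius graph to the orbits of `G` on the irreducible
characters of the normal core of `H`. -/
noncomputable def componentOrbit (H : Subgroup G) :
    (graph H).ConnectedComponent → Orbits H.normalCore :=
  SimpleGraph.ConnectedComponent.lift (orbitUnder H) fun _ _ p _ => by
    induction p with
    | nil => rfl
    | cons h _ ih => exact (orbitUnder_eq_of_adj h).trans (ih (by simp_all))

theorem exists_connectedComponentMk_inl (H : Subgroup G) (C : (graph H).ConnectedComponent) :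
    ∃ χ : Irr G, (graph H).connectedComponentMk (Sum.inl χ) = C := by
  induction C using SimpleGraph.ConnectedComponent.ind with
  | _ v =>
    rcases v with χ | φ
    · exact ⟨χ, rfl⟩
    · obtain ⟨χ, h⟩ := φ.exists_inner_res_ne_zero_left
      have ha : (graph H).Adj (Sum.inl χ) (Sum.inr φ) := h
      exact ⟨χ, SimpleGraph.ConnectedComponent.sound ha.reachable⟩

theorem componentOrbit_bijective (H : Subgroup G) : Function.Bijective (componentOrbit H) := by
  constructor
  · intro C C' h
    obtain ⟨χ, rfl⟩ := exists_connectedComponentMk_inl H C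
    obtain ⟨χ', rfl⟩ := exists_connectedComponentMk_inl H C'
    obtain ⟨θ, hθ⟩ := χ.exists_inner_res_ne_zero H.normalCore
    have h1 : orbitUnder H (Sum.inl χ) = orbitOf θ := (orbitUnder_inl_eq_iff H χ θ).2 hθ
    have h2 : orbitUnder H (Sum.inl χ') = orbitOf θ := (Eq.symm h).trans h1
    exact SimpleGraph.ConnectedComponent.sound
      (reachable_of_inner_res_normalCore H hθ ((orbitUnder_inl_eq_iff H χ' θ).1 h2))
  · rintro ⟨θ⟩
    obtain ⟨χ, hχ⟩ := θ.exists_inner_res_ne_zero_left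
    exact ⟨(graph H).connectedComponentMk (Sum.inl χ), (orbitUnder_inl_eq_iff H χ θ).2 hχ⟩

/-- Any χ above φ also lies above θ, so the claim reduces to χ. -/
theorem orbitUnder_inr_eq {H : Subgroup G} {φ : Irr H} {θ : Irr H.normalCore}
    (h : inner (resLE H.normalCore_le φ.1) θ.1 ≠ 0) :
    orbitUnder H (Sum.inr φ) = orbitOf θ := by
  obtain ⟨χ, hχ⟩ := φ.exists_inner_res_ne_zero_left
  rw [← orbitUnder_inl_eq_inr hχ, orbitUnder_inl_eq_iff]
  exact inner_res_ne_zero_of_adj hχ h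

/-! ### Connectedness and triviality of the core -/

omit [Finite G] in
theorem exists_irr_eq_one : ∃ χ : Irr G, χ.1 = 1 := by
  have h : IsIrrChar (1 : G → ℂ) := by
    refine ⟨ℂ, inferInstance, inferInstance, inferInstance, Representation.trivial ℂ G ℂ, ?_, ?_⟩
    · have hs : IsSimpleOrder (Submodule ℂ ℂ) := inferInstanceAs (IsSimpleOrder (Ideal ℂ))
      exact { exists_pair_ne := ⟨⊥, ⊤, fun h => bot_ne_top (α := Submodule ℂ ℂ)
                (congrArg Subrepresentation.toSubmodule h)⟩
              eq_bot_or_eq_top := fun S => (hs.eq_bot_or_eq_top S.toSubmodule).imp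
                (fun h => Subrepresentation.toSubmodule_injective h)
                (fun h => Subrepresentation.toSubmodule_injective h) }
    · ext g
      simp [Representation.character, Representation.trivial]
  exact ⟨⟨1, h⟩, rfl⟩

/-- A normal subgroup is trivial iff its irreducible characters form a single orbit. -/
theorem subsingleton_orbits_iff (K : Subgroup G) [K.Normal] :
    Subsingleton (Orbits K) ↔ K = ⊥ := by
  classical
  obtain ⟨ε, hε⟩ := exists_irr_eq_one (G := K)
  constructor
  · intro hs
    have hall (θ : Irr K) : θ.1 = 1 := by
      obtain ⟨g, hg⟩ := orbitOf_eq_iff.1 (hs.elim (orbitOf θ) (orbitOf ε))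
      rw [← hg]
      ext k
      exact congrFun hε _
    -- If all irreducible characters are trivial, the regular character is constant, yet it vanishes
    -- off 1.
    obtain ⟨ι, _, a, ha⟩ := (isChar_permChar (⊥ : Subgroup K)).exists_eq_sum
    rw [Subgroup.eq_bot_iff_forall]
    intro k hk
    have h1 : permChar (⊥ : Subgroup K) ⟨k, hk⟩ = permChar (⊥ : Subgroup K) 1 := by
      rw [ha]
      simp [hall]
    by_contra hne
    have hne' : (⟨k, hk⟩ : K) ≠ 1 := fun h => hne (congrArg Subtype.val h)
    rw [permChar_bot, permChar_bot, if_neg hne', if_pos rfl] at h1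
    exact Nat.cast_ne_zero.2 Nat.card_pos.ne' h1.symm
  · rintro rfl
    have hs : Subsingleton (Irr (⊥ : Subgroup G)) := ⟨fun θ θ' => by
      -- Over the trivial group the inner product is the single term θ(1)·conj θ'(1), which is
      -- nonzero.
      rw [← inner_irr]
      cases nonempty_fintype (⊥ : Subgroup G)
      rw [inner_eq_sum, Fintype.sum_unique]
      simpa using ⟨θ.one_ne_zero, θ'.one_ne_zero⟩⟩
    exact ⟨by rintro ⟨θ⟩ ⟨θ'⟩; rw [hs.elim θ θ']⟩

end

end FrobeniusGraph

theorem mainTheorem2 {G : Type*} [Group G] [Finite G] (H : Subgroup G) (hH : H ≠ ⊤) :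
    (∃ f : (FrobeniusGraph.graph H).ConnectedComponent ≃ FrobeniusGraph.Orbits H.normalCore,
      (∀ (χ : FrobeniusGraph.Irr G) (θ : FrobeniusGraph.Irr H.normalCore),
        f ((FrobeniusGraph.graph H).connectedComponentMk (Sum.inl χ)) = FrobeniusGraph.orbitOf θ ↔
          FrobeniusGraph.inner (FrobeniusGraph.res H.normalCore χ.1) θ.1 ≠ 0) ∧
      (∀ (φ : FrobeniusGraph.Irr H) (θ : FrobeniusGraph.Irr H.normalCore),
        FrobeniusGraph.inner (FrobeniusGraph.resLE H.normalCore_le φ.1) θ.1 ≠ 0 →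
          f ((FrobeniusGraph.graph H).connectedComponentMk (Sum.inr φ)) =
            FrobeniusGraph.orbitOf θ)) ∧
    ((FrobeniusGraph.graph H).Connected ↔ H.normalCore = ⊥) := by
  let f := Equiv.ofBijective _ (FrobeniusGraph.componentOrbit_bijective H)
  refine ⟨⟨f, FrobeniusGraph.orbitUnder_inl_eq_iff H,
    fun φ θ h => FrobeniusGraph.orbitUnder_inr_eq h⟩, ?_⟩
  rw [← FrobeniusGraph.subsingleton_orbits_iff, ← f.subsingleton_congr,
    SimpleGraph.connected_iff]
  obtain ⟨χ, -⟩ := FrobeniusGraph.exists_irr_eq_one (G := G)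
  refine ⟨fun h => h.1.subsingleton_connectedComponent, fun h => ⟨fun v w => ?_, ⟨Sum.inl χ⟩⟩⟩
  exact SimpleGraph.ConnectedComponent.exact (h.elim _ _)
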